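/- Let $m>0$ and $\omega,d\in\mathbb R$. On $L^2(\mathbb R^2)$ let $H_0=-\frac1{2m}\Delta$, and let $\mathcal D_0$ be the set of all $\Phi\in L^2(\mathbb R^2)$ with $\|\Phi\|=1$ whose unitary Fourier transform $\widehat\varphi(\mathbf p)=(2\pi)^{-1}\int e^{-i\mathbf p\cdot\mathbf x}\Phi(\mathbf x)\,d\mathbf x$ belongs to $C_0^\infty(\mathbb R^2)$ and satisfies $\operatorname{supp}\widehat\varphi\subseteq\{\mathbf p:|\mathbf p-m\mathbf v|<m|\mathbf v|/3\}$ for some $\mathbf v\in\mathbb R^2\setminus\{0\}$. Let $V\in C^1(\mathbb R^2)$ be a real-valued potential of product form $V(x_1,x_2)=V^{(1)}(x_1)\,V^{(2)}(x_2)$ with $V^{(1)},V^{(2)}:\mathbb R\to\mathbb R$ and $\operatorname{supp}V^{(2)}\subseteq[-d,d]$, and suppose that there is an integrable function $h\in L^1([0,\infty))$ such that for all $\rho\ge 0$ $$\rho^{1/2}\sup_{|x_1|\ge\rho}\bigl|V^{(1)}(x_1)\bigr|+\Bigl(\frac1{1+\rho}\Bigr)^{1/2}\sup_{|x_1|\ge\rho}\Bigl|\frac{d}{dx_1}V^{(1)}(x_1)\Bigr|\le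 h(\rho).$$ Let $V_t(\mathbf x)=V(\mathcal R(t)^{-1}\mathbf x)$, where $\mathcal R(t)$ is the rotation of the plane by the angle $\omega t$. Then for every $\Phi\in\mathcal D_0$ there is a positive function $\widetilde h\in L^1(\mathbb R)$ (depending on $\Phi$) such that for all $t\in\mathbb R$ $$\|V_t\,e^{-iH_0t}\,\Phi\|\le\frac{\widetilde h(t)}{1+|t|}\qquad\text{and}\qquad\|(\partial_tV_t)\,e^{-iH_0t}\,\Phi\|\le\widetilde h(t),$$ where $V_t$ and $\partial_tV_t$ act as multiplication operators and $\|\cdot\|$ is the norm of $L^2(\mathbb R^2)$. -/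

import Mathlib

open MeasureTheory
open scoped ENNReal FourierTransform

noncomputable section

/-- Configuration space (and momentum space) `ℝ^ν` with its Euclidean norm and Lebesgue measure. -/
abbrev Space (ν : ℕ) : Type := EuclideanSpace ℝ (Fin ν)

/-- The Hilbert space `L²(ℝ^ν)` of quantum states. -/
abbrev StateSpace (ν : ℕ) : Type := Lp ℂ 2 (volume : Measure (Space ν))

/-- The momentum space wave function of `Φ`, in the unitary normalization
`φ̂(p) = (2π)^{-ν/2} ∫ e^{-i p·x} Φ(x) dx` (extended to `L²`; determined almost everywhere).
Mathlib's Fourier transform is `𝓕 Φ(ξ) = ∫ e^{-2πi ξ·x} Φ(x) dx`, so that `p = 2πξ`. -/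
def momentumWaveFunction {ν : ℕ} (Φ : StateSpace ν) (p : Space ν) : ℂ :=
  (((2 * Real.pi) ^ (-(ν : ℝ) / 2) : ℝ) : ℂ) * (𝓕 Φ : StateSpace ν) ((2 * Real.pi)⁻¹ • p)

/-- The set `D₀` of unit vectors whose momentum space wave function is (almost everywhere equal to)
a smooth compactly supported function with support in the open ball `B_{m|v|/3}(m v)`
for some velocity `v ≠ 0`. -/
def localizedStates (ν : ℕ) (m : ℝ) : Set (StateSpace ν) :=
  {Φ | ‖Φ‖ = 1 ∧ ∃ g : Space ν → ℂ,
    ContDiff ℝ (⊤ : ℕ∞) g ∧ HasCompactSupport g ∧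
    momentumWaveFunction Φ =ᵐ[volume] g ∧
    ∃ v : Space ν, v ≠ 0 ∧ tsupport g ⊆ Metric.ball (m • v) (m * ‖v‖ / 3)}

/-- The phase `e^{-i t |p|²/(2m)}` by which the free evolution acts in momentum space. -/
def freePhase {ν : ℕ} (m t : ℝ) (p : Space ν) : ℂ :=
  Complex.exp (-(Complex.I * ((t * (‖p‖ ^ 2 / (2 * m)) : ℝ) : ℂ)))

lemma norm_freePhase {ν : ℕ} (m t : ℝ) (p : Space ν) : ‖freePhase m t p‖ = 1 := by
  rw [freePhase, ← mul_neg, ← Complex.ofReal_neg, mul_comm, Complex.norm_exp_ofReal_mul_I]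

lemma continuous_freePhase {ν : ℕ} (m t : ℝ) : Continuous (freePhase (ν := ν) m t) := by
  unfold freePhase
  fun_prop

lemma memLp_freePhase_mul {ν : ℕ} (m t : ℝ) (f : StateSpace ν) :
    MemLp (fun ξ : Space ν => freePhase m t ((2 * Real.pi) • ξ) * f ξ) 2 volume := by
  refine (Lp.memLp f).of_le ?_ (Filter.Eventually.of_forall fun ξ => ?_)
  · exact ((continuous_freePhase m t).comp (continuous_const_smul _)).aestronglyMeasurable.mul
      (Lp.aestronglyMeasurable f)
  · simp [norm_freePhase]

/-- The free evolution `e^{-i t H₀}` on `L²(ℝ^ν)` generated by `H₀ = -Δ/(2m) = |p|²/(2m)`: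
multiplication by `e^{-i t |p|²/(2m)}` in momentum space, where `p = 2πξ`. -/
def freeEvolution {ν : ℕ} (m t : ℝ) (Φ : StateSpace ν) : StateSpace ν :=
  𝓕⁻ ((memLp_freePhase_mul m t (𝓕 Φ : StateSpace ν)).toLp _ : StateSpace ν)

/-- The rotation of the plane by the angle `θ`. -/
def planeRotation (θ : ℝ) : Space 2 ≃ Space 2 where
  toFun x := !₂[Real.cos θ * x 0 - Real.sin θ * x 1, Real.sin θ * x 0 + Real.cos θ * x 1]
  invFun x := !₂[Real.cos θ * x 0 + Real.sin θ * x 1, -Real.sin θ * x 0 + Real.cos θ * x 1]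
  left_inv x := by
    ext i
    fin_cases i
    · simp
      linear_combination x 0 * Real.sin_sq_add_cos_sq θ
    · simp
      linear_combination x 1 * Real.sin_sq_add_cos_sq θ
  right_inv x := by
    ext i
    fin_cases i
    · simp
      linear_combination x 0 * Real.sin_sq_add_cos_sq θ
    · simp
      linear_combination x 1 * Real.sin_sq_add_cos_sq θ

/-- The rotating potential `V_t(x) = V(R(t)⁻¹ x)`, where `R(t)` is the rotation by `ω t`. -/
def rotatingPotential (ω : ℝ) (V : Space 2 → ℝ) (t : ℝ) (x : Space 2) : ℝ :=
  V ((planeRotation (ω * t)).symm x)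

/-- The time derivative `∂_t V_t(x)` of the rotating potential. -/
def rotatingPotentialDeriv (ω : ℝ) (V : Space 2 → ℝ) (t : ℝ) (x : Space 2) : ℝ :=
  deriv (fun s => rotatingPotential ω V s x) t

/-- `‖W Ψ‖ ≤ c` for the operator of multiplication by the function `W`; this includes that `Ψ`
is in the domain of that operator, i.e. that `W Ψ` is in `L²`. -/
def MulNormLE {ν : ℕ} (W : Space ν → ℝ) (Ψ : StateSpace ν) (c : ℝ) : Prop :=
  MemLp (fun x => (W x : ℂ) * Ψ x) 2 volume ∧
    eLpNorm (fun x => (W x : ℂ) * Ψ x) 2 volume ≤ ENNReal.ofReal c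

/-- `sup_{|y| ≥ ρ} |f(y)|` as an element of `[0, ∞]`. -/
def tailSup (f : ℝ → ℝ) (ρ : ℝ) : ℝ≥0∞ :=
  ⨆ y ∈ {y : ℝ | ρ ≤ |y|}, ‖f y‖ₑ

end

noncomputable section

/-! The state travels with velocity close to `v ≠ 0`, while `V_t` lives in a rotating strip of fixed
width, so at time `t` it is felt only on a piece of the strip of length of order `|t|`, at distance
of order `|t|` from the origin.

The explicit propagator writes the evolved state as `1/|t|`, times a phase, times the Fourier
transform of the chirped initial state at a multiple of `x/t`. This gives a uniform bound `C/|t|`.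
Expanding the chirp to second order produces only terms whose Fourier transforms stay in the
original momentum support; Plancherel bounds the remainder, so the `L²` mass outside the ball of
radius `|t|‖v‖/3` about `t • v` is `O(|t|⁻³)` (`exists_freeEvolution_bounds`).

Inside that ball the strip has area `O(|t|)` and its long coordinate is at least `ρ = c|t|`, with `c
= ‖v‖/2` (`mulNormLE_of_strip`). For large `|t|`, up to constants, the potential there is at most
`|h ρ|/√ρ` and its time derivative at most `√ρ|h ρ|`. Multiplying by `1/|t|` and by the root of the
area, of order `√ρ`, gives `|h ρ|/|t|` and `|h ρ|`, integrable in the required sense. Bounded times,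
and the mass outside the ball, are handled by boundedness of both multipliers. -/

/-! ### Quadratic phases and the free propagator in the plane. -/

lemma hasTemperateGrowth_cexp_mul_I :
    (fun s : ℝ => Complex.exp (s * Complex.I)).HasTemperateGrowth := by
  have hd : ∀ n : ℕ, iteratedDeriv n (fun s : ℝ => Complex.exp (s * Complex.I)) =
      fun s : ℝ => Complex.I ^ n * Complex.exp (s * Complex.I) := by
    intro n
    induction n with
    | zero => simp
    | succ n ih =>
      rw [iteratedDeriv_succ, ih]
      ext s
      have h1 : HasDerivAt (fun s : ℝ => (s : ℂ) * Complex.I) (1 * Complex.I) s :=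
        (Complex.ofRealCLM.hasDerivAt (x := s)).mul_const Complex.I
      have h2 := (h1.cexp).const_mul (Complex.I ^ n)
      rw [h2.deriv]
      ring
  refine ⟨Complex.contDiff_exp.comp (Complex.ofRealCLM.contDiff.mul contDiff_const), fun n => ⟨0, 1, fun x => ?_⟩⟩
  rw [norm_iteratedFDeriv_eq_norm_iteratedDeriv, hd]
  simp [Complex.norm_exp_ofReal_mul_I]

/-- The quadratic phase `e^{i a |y|²}`. -/
def quadPhase {ν : ℕ} (a : ℝ) (y : Space ν) : ℂ := Complex.exp ((a * ‖y‖ ^ 2 : ℝ) * Complex.I)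

lemma hasTemperateGrowth_quadPhase {ν : ℕ} (a : ℝ) :
    (quadPhase (ν := ν) a).HasTemperateGrowth := by
  have h1 : (fun y : Space ν => a * ‖y‖ ^ 2).HasTemperateGrowth :=
    (Function.HasTemperateGrowth.const a).mul (Function.hasTemperateGrowth_norm_sq _)
  exact hasTemperateGrowth_cexp_mul_I.comp h1

lemma norm_quadPhase {ν : ℕ} (a : ℝ) (y : Space ν) : ‖quadPhase a y‖ = 1 :=
  Complex.norm_exp_ofReal_mul_I _

open SchwartzMap in
/-- `e^{-b|ξ|²}` as a multiplier is given by convolution with a Gaussian when `0 < Re b`. -/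
lemma integral_gaussian_mul_fourier (φ : 𝓢(Space 2, ℂ)) {b : ℂ} (hb : 0 < b.re) (x : Space 2) :
    ∫ ξ, Complex.exp (-b * ‖ξ‖ ^ 2 + 2 * Real.pi * Complex.I * inner ℝ x ξ) * 𝓕 φ ξ =
      ∫ y, (Real.pi / b) * Complex.exp (-Real.pi ^ 2 * ‖x - y‖ ^ 2 / b) * φ y := by
  have hint : Integrable (fun ξ : Space 2 =>
      Complex.exp (-b * ‖ξ‖ ^ 2 + 2 * Real.pi * Complex.I * inner ℝ x ξ)) :=
    GaussianFourier.integrable_cexp_neg_mul_sq_norm_add hb _ x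
  have h := VectorFourier.integral_fourierIntegral_smul_eq_flip (μ := volume) (ν := volume)
    (L := innerₗ (Space 2)) Real.continuous_fourierChar continuous_inner hint φ.integrable
  have hg : ∀ y : Space 2, VectorFourier.fourierIntegral Real.fourierChar volume
      (innerₗ (Space 2)) (fun ξ : Space 2 => Complex.exp (-b * ‖ξ‖ ^ 2 +
        2 * Real.pi * Complex.I * inner ℝ x ξ)) y =
      (Real.pi / b) * Complex.exp (-Real.pi ^ 2 * ‖x - y‖ ^ 2 / b) := by
    intro y
    have := fourier_gaussian_innerProductSpace' hb x y
    simp only [finrank_euclideanSpace, Fintype.card_fin, Nat.cast_ofNat, div_self_of_invertible,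
      Complex.cpow_one] at this
    rw [← this]
    rfl
  simp only [hg, smul_eq_mul, flip_innerₗ] at h
  rw [h]
  rfl

open SchwartzMap Filter Topology in
/-- The propagator of the free Schrödinger equation in the plane. -/
lemma integral_quadPhase_mul_fourier (φ : 𝓢(Space 2, ℂ)) {a : ℝ} (ha : a ≠ 0) (x : Space 2) :
    ∫ ξ, Complex.exp (2 * Real.pi * Complex.I * inner ℝ x ξ) * quadPhase (-a) ξ * 𝓕 φ ξ =
      (Real.pi / (a * Complex.I)) * ∫ y, quadPhase (Real.pi ^ 2 / a) (x - y) * φ y := by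
  have hI : (a : ℂ) * Complex.I ≠ 0 := by simp [ha]
  -- The oscillatory integral is the limit `ε → 0+` of the Gaussian identity with `b = ε + ia`.
  -- Dominated convergence applies on both sides because `Re b` and `Re (1/b)` are nonnegative and
  -- `|a| ≤ ‖b‖`.
  have hb : Tendsto (fun ε : ℝ => (ε : ℂ) + a * Complex.I) (𝓝[>] 0) (𝓝 (a * Complex.I)) := by
    have : Tendsto (fun ε : ℝ => (ε : ℂ) + a * Complex.I) (𝓝 0) (𝓝 ((0 : ℝ) + a * Complex.I)) :=
      Continuous.tendsto (by fun_prop) 0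
    simp only [Complex.ofReal_zero, zero_add] at this
    exact this.mono_left nhdsWithin_le_nhds
  have hre : ∀ ε : ℝ, ((ε : ℂ) + a * Complex.I).re = ε := by simp
  have hL : Tendsto (fun ε : ℝ => ∫ ξ, Complex.exp (-((ε : ℂ) + a * Complex.I) * ‖ξ‖ ^ 2 +
      2 * Real.pi * Complex.I * inner ℝ x ξ) * 𝓕 φ ξ) (𝓝[>] 0)
      (𝓝 (∫ ξ, Complex.exp (-(a * Complex.I) * ‖ξ‖ ^ 2 +
      2 * Real.pi * Complex.I * inner ℝ x ξ) * 𝓕 φ ξ)) := by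
    refine tendsto_integral_filter_of_dominated_convergence (fun ξ => ‖𝓕 φ ξ‖) ?_ ?_ ?_ ?_
    · refine Eventually.of_forall fun ε => Continuous.aestronglyMeasurable ?_
      exact Continuous.mul (by fun_prop) (𝓕 φ).continuous
    · filter_upwards [self_mem_nhdsWithin] with ε hε
      refine Eventually.of_forall fun ξ => ?_
      rw [norm_mul, Complex.norm_exp]
      refine mul_le_of_le_one_left (norm_nonneg _) (Real.exp_le_one_iff.2 ?_)
      have : (-((ε : ℂ) + a * Complex.I) * ‖ξ‖ ^ 2 +
        2 * Real.pi * Complex.I * inner ℝ x ξ).re = -(ε * ‖ξ‖ ^ 2) := by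
        simp [← Complex.ofReal_pow]
      rw [this]
      have : 0 < ε := hε
      simp only [Left.neg_nonpos_iff]
      positivity
    · exact (𝓕 φ).integrable.norm
    · refine Eventually.of_forall fun ξ => ?_
      refine Tendsto.mul_const _ ((Complex.continuous_exp.tendsto _).comp ?_)
      exact (hb.neg.mul_const _).add_const _
  have hR : Tendsto (fun ε : ℝ => ∫ y, (Real.pi / ((ε : ℂ) + a * Complex.I)) *
      Complex.exp (-Real.pi ^ 2 * ‖x - y‖ ^ 2 / ((ε : ℂ) + a * Complex.I)) * φ y) (𝓝[>] 0)
      (𝓝 (∫ y, (Real.pi / (a * Complex.I)) *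
      Complex.exp (-Real.pi ^ 2 * ‖x - y‖ ^ 2 / (a * Complex.I)) * φ y)) := by
    refine tendsto_integral_filter_of_dominated_convergence
      (fun y => Real.pi / |a| * ‖φ y‖) ?_ ?_ ?_ ?_
    · refine Eventually.of_forall fun ε => Continuous.aestronglyMeasurable ?_
      exact Continuous.mul (by fun_prop) φ.continuous
    · filter_upwards [self_mem_nhdsWithin] with ε hε
      have hε : 0 < ε := hε
      refine Eventually.of_forall fun y => ?_
      rw [norm_mul, norm_mul, Complex.norm_exp, norm_div, Complex.norm_real,
        Real.norm_of_nonneg Real.pi_pos.le]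
      have h1 : |a| ≤ ‖(ε : ℂ) + a * Complex.I‖ := by
        simpa using Complex.abs_im_le_norm ((ε : ℂ) + a * Complex.I)
      have h2 : (-(Real.pi : ℂ) ^ 2 * ‖x - y‖ ^ 2 / ((ε : ℂ) + a * Complex.I)).re ≤ 0 := by
        rw [show -(Real.pi : ℂ) ^ 2 * ‖x - y‖ ^ 2 = ((-(Real.pi ^ 2 * ‖x - y‖ ^ 2) : ℝ) : ℂ) by
          push_cast; ring, div_eq_mul_inv, Complex.re_ofReal_mul, Complex.inv_re, hre]
        have := Complex.normSq_nonneg ((ε : ℂ) + a * Complex.I)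
        have : 0 ≤ Real.pi ^ 2 * ‖x - y‖ ^ 2 * (ε / Complex.normSq ((ε : ℂ) + a * Complex.I)) := by
          positivity
        linarith
      have h3 := Real.exp_le_one_iff.2 h2
      have h4 : Real.pi / ‖(ε : ℂ) + a * Complex.I‖ ≤ Real.pi / |a| :=
        div_le_div_of_nonneg_left Real.pi_pos.le (abs_pos.2 ha) h1
      refine mul_le_mul_of_nonneg_right ?_ (norm_nonneg _)
      calc _ ≤ Real.pi / ‖(ε : ℂ) + a * Complex.I‖ * 1 :=
            mul_le_mul_of_nonneg_left h3 (by positivity)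
        _ ≤ _ := by simpa using h4
    · exact φ.integrable.norm.const_mul _
    · refine Eventually.of_forall fun y => ?_
      refine Tendsto.mul_const _ (Tendsto.mul (tendsto_const_nhds.div hb hI) ?_)
      exact (Complex.continuous_exp.tendsto _).comp (tendsto_const_nhds.div hb hI)
  have heq := hL.congr' (f₂ := fun ε : ℝ => ∫ y, (Real.pi / ((ε : ℂ) + a * Complex.I)) *
      Complex.exp (-Real.pi ^ 2 * ‖x - y‖ ^ 2 / ((ε : ℂ) + a * Complex.I)) * φ y) (by
    filter_upwards [self_mem_nhdsWithin] with ε hε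
    exact integral_gaussian_mul_fourier φ (by rw [hre]; exact hε) x)
  have key := tendsto_nhds_unique heq hR
  rw [← integral_const_mul]
  refine (integral_congr_ae (ae_of_all _ fun ξ => ?_)).trans
    (key.trans (integral_congr_ae (ae_of_all _ fun y => ?_)))
  · simp only [quadPhase]
    rw [← Complex.exp_add]
    congr 2
    push_cast
    ring
  · simp only [quadPhase]
    rw [mul_assoc]
    congr 3
    push_cast
    have : (a : ℂ) ≠ 0 := by simp [ha]
    field_simp
    simp

/-- The free evolution in terms of the Fourier transform of the chirped state. -/
lemma fourierInv_quadPhase_mul_fourier (φ : SchwartzMap (Space 2) ℂ) {a : ℝ} (ha : a ≠ 0)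
    (x : Space 2) :
    𝓕⁻ (SchwartzMap.smulLeftCLM ℂ (quadPhase (-a)) (𝓕 φ)) x =
      (Real.pi / (a * Complex.I)) * quadPhase (Real.pi ^ 2 / a) x *
        𝓕 (SchwartzMap.smulLeftCLM ℂ (quadPhase (Real.pi ^ 2 / a)) φ) ((Real.pi / a) • x) := by
  rw [SchwartzMap.fourierInv_coe, SchwartzMap.fourier_coe, Real.fourierInv_eq', Real.fourier_eq']
  have h := integral_quadPhase_mul_fourier φ ha x
  rw [mul_assoc, ← integral_const_mul]
  refine (integral_congr_ae (ae_of_all _ fun ξ => ?_)).trans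
    (h.trans (congrArg _ (integral_congr_ae (ae_of_all _ fun y => ?_))))
  · simp only [SchwartzMap.smulLeftCLM_apply_apply (hasTemperateGrowth_quadPhase _), smul_eq_mul]
    rw [← mul_assoc]
    congr 3
    rw [real_inner_comm]
    push_cast
    ring
  · simp only [SchwartzMap.smulLeftCLM_apply_apply (hasTemperateGrowth_quadPhase _), smul_eq_mul]
    rw [← mul_assoc, ← mul_assoc]
    congr 1
    rw [quadPhase, quadPhase, quadPhase, ← Complex.exp_add, ← Complex.exp_add, norm_sub_sq_real,
      inner_smul_right, real_inner_comm]
    congr 1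
    push_cast
    have : (a : ℂ) ≠ 0 := by simp [ha]
    field_simp
    ring

/-! ### Smallness of a chirped function off its momentum support. -/

lemma norm_cexp_mul_I_sub_taylor_le (θ : ℝ) :
    ‖Complex.exp (θ * Complex.I) - 1 - θ * Complex.I + θ ^ 2 / 2‖ ≤ 4 * |θ| ^ 3 := by
  rcases le_total |θ| 1 with h | h
  · have h1 : ‖(θ : ℂ) * Complex.I‖ ≤ 1 := by simpa using h
    have h2 := Complex.exp_bound h1 (n := 3) (by norm_num)
    have h3 : Complex.exp (θ * Complex.I) - 1 - θ * Complex.I + θ ^ 2 / 2 =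
        Complex.exp (θ * Complex.I) -
          ∑ k ∈ Finset.range 3, ((θ : ℂ) * Complex.I) ^ k / k.factorial := by
      simp only [Finset.sum_range_succ, Finset.sum_range_zero, mul_pow, Complex.I_sq]
      simp
      ring
    rw [h3]
    refine h2.trans ?_
    have : ‖(θ : ℂ) * Complex.I‖ = |θ| := by simp
    rw [this, mul_comm]
    refine mul_le_mul_of_nonneg_right ?_ (by positivity)
    norm_num [Nat.factorial]
  · have h1 : ‖Complex.exp (θ * Complex.I)‖ = 1 := Complex.norm_exp_ofReal_mul_I θ
    have h2 : ‖(θ : ℂ) * Complex.I‖ = |θ| := by simp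
    have h3 : ‖(θ : ℂ) ^ 2 / 2‖ = |θ| ^ 2 / 2 := by simp
    calc _ ≤ ‖Complex.exp (θ * Complex.I)‖ + ‖(1 : ℂ)‖ + ‖(θ : ℂ) * Complex.I‖ +
          ‖(θ : ℂ) ^ 2 / 2‖ :=
          (norm_add_le _ _).trans (add_le_add_left ((norm_sub_le _ _).trans
            (add_le_add_left (norm_sub_le _ _) _)) _)
      _ = 2 + |θ| + |θ| ^ 2 / 2 := by rw [h1, h2, h3, norm_one]; ring
      _ ≤ 4 * |θ| ^ 3 := by
          have h4 : |θ| ^ 1 ≤ |θ| ^ 3 := pow_le_pow_right₀ h (by norm_num)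
          have h5 : |θ| ^ 2 ≤ |θ| ^ 3 := pow_le_pow_right₀ h (by norm_num)
          have h6 : 1 ≤ |θ| ^ 3 := one_le_pow₀ h
          linarith

section

open SchwartzMap LineDeriv

/-- Multiplication by a linear form is, up to a nonzero constant, differentiation of the Fourier
transform, which cannot enlarge the support. -/
lemma tsupport_fourier_smulLeftCLM_inner_subset {ν : ℕ} (φ : 𝓢(Space ν, ℂ)) (m : Space ν) :
    tsupport (𝓕 (smulLeftCLM ℂ (inner ℝ · m) φ) : 𝓢(Space ν, ℂ)) ⊆ tsupport (𝓕 φ : 𝓢(Space ν, ℂ)) := by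
  have h := lineDerivOp_fourier_eq φ m
  have hc : (-(2 * Real.pi * Complex.I) : ℂ) ≠ 0 := by simp [Real.pi_ne_zero]
  have h2 : 𝓕 (smulLeftCLM ℂ (inner ℝ · m) φ) =
      (-(2 * Real.pi * Complex.I) : ℂ)⁻¹ • ∂_{m} (𝓕 φ) := by
    rw [h, FourierTransform.fourier_smul, smul_smul, inv_mul_cancel₀ hc, one_smul]
  rw [h2]
  exact (tsupport_smul_subset_right (fun _ => (-(2 * Real.pi * Complex.I) : ℂ)⁻¹) _).trans
    (tsupport_lineDerivOp_subset m _)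

lemma tsupport_fourier_smulLeftCLM_norm_sq_subset {ν : ℕ} (φ : 𝓢(Space ν, ℂ)) :
    tsupport (𝓕 (smulLeftCLM ℂ (fun y : Space ν => ‖y‖ ^ 2) φ) : 𝓢(Space ν, ℂ)) ⊆ tsupport (𝓕 φ : 𝓢(Space ν, ℂ)) := by
  have hg : ∀ m : Space ν, (fun y : Space ν => inner ℝ y m).HasTemperateGrowth := fun m => by
    fun_prop
  have h : smulLeftCLM ℂ (fun y : Space ν => ‖y‖ ^ 2) φ =
      ∑ i : Fin ν, smulLeftCLM ℂ (inner ℝ · (EuclideanSpace.single i (1 : ℝ)))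
        (smulLeftCLM ℂ (inner ℝ · (EuclideanSpace.single i (1 : ℝ))) φ) := by
    ext y
    rw [smulLeftCLM_apply_apply (Function.hasTemperateGrowth_norm_sq _), sum_apply]
    simp only [smulLeftCLM_apply_apply (hg _)]
    rw [EuclideanSpace.real_norm_sq_eq, Finset.sum_smul]
    refine Finset.sum_congr rfl fun i _ => ?_
    rw [smul_smul]
    simp [EuclideanSpace.inner_single_right, sq]
  have h2 : 𝓕 (smulLeftCLM ℂ (fun y : Space ν => ‖y‖ ^ 2) φ) =
      ∑ i : Fin ν, 𝓕 (smulLeftCLM ℂ (inner ℝ · (EuclideanSpace.single i (1 : ℝ)))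
        (smulLeftCLM ℂ (inner ℝ · (EuclideanSpace.single i (1 : ℝ))) φ)) := by
    rw [h]
    exact map_sum (FourierTransform.fourierCLM ℂ 𝓢(Space ν, ℂ)) _ _
  refine closure_minimal (fun y hy => ?_) (isClosed_tsupport _)
  by_contra hy'
  refine hy ?_
  rw [h2, sum_apply]
  refine Finset.sum_eq_zero fun i _ => image_eq_zero_of_notMem_tsupport fun hi => hy' ?_
  exact tsupport_fourier_smulLeftCLM_inner_subset _ _
    (tsupport_fourier_smulLeftCLM_inner_subset _ _ hi)

/-- Off the support of its Fourier transform, a chirped Schwartz function has a Fourier transform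
that is small in `L²`. -/
lemma eLpNorm_indicator_fourier_quadPhase_le {ν : ℕ} (φ : 𝓢(Space ν, ℂ)) :
    ∃ C : ℝ, 0 ≤ C ∧ ∀ b : ℝ,
      eLpNorm ((tsupport (𝓕 φ : 𝓢(Space ν, ℂ)))ᶜ.indicator (𝓕 (smulLeftCLM ℂ (quadPhase b) φ) : 𝓢(Space ν, ℂ))) 2 volume ≤
        ENNReal.ofReal (C * |b| ^ 3) := by
  set L : 𝓢(Space ν, ℂ) → 𝓢(Space ν, ℂ) := fun f => smulLeftCLM ℂ (fun y : Space ν => ‖y‖ ^ 2) f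
    with hL
  have hLa : ∀ f y, L f y = (‖y‖ ^ 2 : ℝ) • f y := fun f y =>
    smulLeftCLM_apply_apply (Function.hasTemperateGrowth_norm_sq _) f y
  refine ⟨4 * (eLpNorm (L (L (L φ))) 2 volume).toReal, by positivity, fun b => ?_⟩
  -- The subtracted Taylor terms are `φ` times powers of `‖y‖²`, so their Fourier transforms vanish
  -- off the support of `𝓕 φ`; there the chirped function and `R` have the same transform.
  set R : 𝓢(Space ν, ℂ) := smulLeftCLM ℂ (quadPhase b) φ - φ - (b * Complex.I) • L φ
    + ((b : ℂ) ^ 2 / 2) • L (L φ) with hR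
  have h1 : 𝓕 R = 𝓕 (smulLeftCLM ℂ (quadPhase b) φ) - 𝓕 φ - (b * Complex.I) • 𝓕 (L φ)
      + ((b : ℂ) ^ 2 / 2) • 𝓕 (L (L φ)) := by
    have := map_add (FourierTransform.fourierCLM ℂ 𝓢(Space ν, ℂ))
      (smulLeftCLM ℂ (quadPhase b) φ - φ - (b * Complex.I) • L φ) (((b : ℂ) ^ 2 / 2) • L (L φ))
    rw [map_sub, map_sub, map_smul, map_smul] at this
    exact this
  have h2 : (tsupport (𝓕 φ : 𝓢(Space ν, ℂ)))ᶜ.indicator (𝓕 (smulLeftCLM ℂ (quadPhase b) φ) : 𝓢(Space ν, ℂ)) =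
      (tsupport (𝓕 φ : 𝓢(Space ν, ℂ)))ᶜ.indicator (𝓕 R : 𝓢(Space ν, ℂ)) := by
    refine Set.indicator_congr fun q hq => ?_
    have e0 : 𝓕 φ q = 0 := image_eq_zero_of_notMem_tsupport hq
    have e1 : 𝓕 (L φ) q = 0 := image_eq_zero_of_notMem_tsupport fun h =>
      hq (tsupport_fourier_smulLeftCLM_norm_sq_subset _ h)
    have e2 : 𝓕 (L (L φ)) q = 0 := image_eq_zero_of_notMem_tsupport fun h =>
      hq (tsupport_fourier_smulLeftCLM_norm_sq_subset _
        (tsupport_fourier_smulLeftCLM_norm_sq_subset _ h))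
    rw [h1]
    simp [e0, e1, e2]
  have h3 : eLpNorm (𝓕 R : 𝓢(Space ν, ℂ)) 2 volume = eLpNorm R 2 volume := by
    have := norm_fourier_toL2_eq R
    rw [SchwartzMap.norm_toLp, SchwartzMap.norm_toLp] at this
    exact (ENNReal.toReal_eq_toReal_iff' ((𝓕 R).memLp 2 volume).2.ne
      (R.memLp 2 volume).2.ne).1 this
  have h4 : ∀ y, ‖R y‖ ≤ 4 * |b| ^ 3 * ‖L (L (L φ)) y‖ := by
    intro y
    have e : R y = (Complex.exp ((b * ‖y‖ ^ 2 : ℝ) * Complex.I) - 1 -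
        (b * ‖y‖ ^ 2 : ℝ) * Complex.I + ((b * ‖y‖ ^ 2 : ℝ) : ℂ) ^ 2 / 2) * φ y := by
      simp only [hR, add_apply, sub_apply, smul_apply, hLa,
        smulLeftCLM_apply_apply (hasTemperateGrowth_quadPhase b), quadPhase, smul_eq_mul,
        Complex.real_smul]
      push_cast
      ring
    rw [e, norm_mul, hLa, hLa, hLa, norm_smul, norm_smul, norm_smul]
    have := norm_cexp_mul_I_sub_taylor_le (b * ‖y‖ ^ 2)
    refine (mul_le_mul_of_nonneg_right this (norm_nonneg _)).trans (le_of_eq ?_)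
    rw [abs_mul, Real.norm_eq_abs, abs_of_nonneg (by positivity : 0 ≤ ‖y‖ ^ 2)]
    ring
  rw [h2]
  refine (eLpNorm_indicator_le _).trans ?_
  rw [h3]
  refine (eLpNorm_le_mul_eLpNorm_of_ae_le_mul (Filter.Eventually.of_forall h4) 2).trans ?_
  have hf := ((L (L (L φ))).memLp 2 volume).2.ne
  conv_lhs => rw [← ENNReal.ofReal_toReal hf]
  rw [← ENNReal.ofReal_mul (by positivity)]
  exact le_of_eq (congrArg _ (by ring))

/-! ### Dispersive bounds for Schwartz data. -/

lemma eLpNorm_comp_smul (f : Space 2 → ℂ) (r : ℝ) (hr : r ≠ 0) :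
    eLpNorm (fun x => f (r • x)) 2 volume = ENNReal.ofReal (|r|⁻¹) * eLpNorm f 2 volume := by
  have he := (Homeomorph.smulOfNeZero r hr : Space 2 ≃ₜ Space 2).measurableEmbedding
  have h := he.eLpNorm_map_measure (μ := volume) (g := f) (p := 2)
  have h2 : Measure.map (Homeomorph.smulOfNeZero r hr : Space 2 ≃ₜ Space 2) volume =
      ENNReal.ofReal |(r ^ 2)⁻¹| • (volume : Measure (Space 2)) := by
    have := Measure.map_addHaar_smul (volume : Measure (Space 2)) hr
    simpa using this
  rw [h2] at h
  refine h.symm.trans ?_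
  rw [eLpNorm_smul_measure_of_ne_top (by norm_num), smul_eq_mul,
    ENNReal.ofReal_rpow_of_nonneg (abs_nonneg _) (by positivity)]
  congr 2
  rw [abs_inv, abs_pow, ← inv_pow]
  simp only [one_div, ENNReal.toReal_inv, ENNReal.toReal_ofNat]
  rw [← one_div (2 : ℝ), ← Real.sqrt_eq_rpow, Real.sqrt_sq (by positivity)]

/-- Decay of the free evolution: uniformly, and in `L²` outside the cone of classical velocities. -/
lemma freeEvolution_schwartz_bounds (φ : 𝓢(Space 2, ℂ)) :
    ∃ C : ℝ, 0 ≤ C ∧ ∀ a : ℝ, a ≠ 0 →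
      (∀ x, ‖(𝓕⁻ (smulLeftCLM ℂ (quadPhase (-a)) (𝓕 φ)) : 𝓢(Space 2, ℂ)) x‖ ≤ C / |a|) ∧
      eLpNorm ({x : Space 2 | (Real.pi / a) • x ∉ tsupport (𝓕 φ : 𝓢(Space 2, ℂ))}.indicator
        (𝓕⁻ (smulLeftCLM ℂ (quadPhase (-a)) (𝓕 φ)) : 𝓢(Space 2, ℂ))) 2 volume ≤ ENNReal.ofReal (C / |a| ^ 3) := by
  obtain ⟨C, hC, h⟩ := eLpNorm_indicator_fourier_quadPhase_le φ
  obtain ⟨K, hK⟩ : ∃ K : ℝ, ∫ x, ‖φ x‖ = K := ⟨_, rfl⟩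
  refine ⟨max (Real.pi * K) (C * Real.pi ^ 6), le_max_of_le_right (by positivity), fun a ha => ?_⟩
  have hn : ∀ x, ‖(𝓕⁻ (smulLeftCLM ℂ (quadPhase (-a)) (𝓕 φ)) : 𝓢(Space 2, ℂ)) x‖ =
      Real.pi / |a| * ‖(𝓕 (smulLeftCLM ℂ (quadPhase (Real.pi ^ 2 / a)) φ) : 𝓢(Space 2, ℂ))
        ((Real.pi / a) • x)‖ := by
    intro x
    rw [fourierInv_quadPhase_mul_fourier φ ha, norm_mul, norm_mul, norm_quadPhase]
    simp [abs_of_pos Real.pi_pos]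
  constructor
  · intro x
    rw [hn]
    -- The chirp has modulus one, so the `L¹` norm bounding the transform does not depend on `a`.
    have h1 : ‖(smulLeftCLM ℂ (quadPhase (Real.pi ^ 2 / a)) φ).toLp 1‖ = K := by
      rw [norm_toLp_one, ← hK]
      simp [smulLeftCLM_apply_apply (hasTemperateGrowth_quadPhase _), norm_quadPhase]
    have h2 := norm_fourier_apply_le_toLp_one
      (smulLeftCLM ℂ (quadPhase (Real.pi ^ 2 / a)) φ) ((Real.pi / a) • x)
    rw [h1] at h2
    have h3 : 0 ≤ Real.pi / |a| := by positivity
    refine (mul_le_mul_of_nonneg_left h2 h3).trans ?_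
    rw [div_mul_eq_mul_div]
    gcongr
    exact le_max_left _ _
  · have hr : Real.pi / a ≠ 0 := div_ne_zero Real.pi_ne_zero ha
    set F := (tsupport (𝓕 φ : 𝓢(Space 2, ℂ)))ᶜ.indicator
      (𝓕 (smulLeftCLM ℂ (quadPhase (Real.pi ^ 2 / a)) φ) : 𝓢(Space 2, ℂ)) with hF
    have h1 : ∀ x, ‖{x : Space 2 | (Real.pi / a) • x ∉ tsupport (𝓕 φ : 𝓢(Space 2, ℂ))}.indicator
        (𝓕⁻ (smulLeftCLM ℂ (quadPhase (-a)) (𝓕 φ)) : 𝓢(Space 2, ℂ)) x‖ ≤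
        Real.pi / |a| * ‖F ((Real.pi / a) • x)‖ := by
      intro x
      by_cases hx : (Real.pi / a) • x ∈ tsupport (𝓕 φ : 𝓢(Space 2, ℂ))
      · rw [Set.indicator_of_notMem (by simpa using hx)]
        simp only [norm_zero]
        positivity
      · rw [Set.indicator_of_mem (by simpa using hx), hF, Set.indicator_of_mem (by simpa using hx),
          hn]
    refine (eLpNorm_le_mul_eLpNorm_of_ae_le_mul (Filter.Eventually.of_forall h1) 2).trans ?_
    -- The dilation contributes `|a|/π`, cancelling the prefactor of the propagator; the cubic gain
    -- survives intact.
    rw [eLpNorm_comp_smul F _ hr]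
    refine (mul_le_mul_right (mul_le_mul_right (h _) _) _).trans ?_
    rw [← ENNReal.ofReal_mul (by positivity), ← ENNReal.ofReal_mul (by positivity)]
    refine ENNReal.ofReal_le_ofReal ?_
    have ha' : |a| ≠ 0 := abs_ne_zero.2 ha
    calc _ = C * Real.pi ^ 6 / |a| ^ 3 := by
          rw [abs_div, abs_div, abs_of_pos Real.pi_pos, abs_of_pos (by positivity : 0 < Real.pi ^ 2)]
          have := Real.pi_ne_zero
          field_simp
      _ ≤ _ := by gcongr; exact le_max_right _ _

end

/-! ### Localized states as Schwartz functions, and their evolution. -/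

section

open SchwartzMap

lemma ae_comp_smul {ν : ℕ} {r : ℝ} (hr : r ≠ 0) {p : Space ν → Prop} (h : ∀ᵐ x, p x) :
    ∀ᵐ x : Space ν, p (r • x) := by
  refine (⟨measurable_const_smul r, ?_⟩ :
    Measure.QuasiMeasurePreserving (fun x : Space ν => r • x) volume volume).ae h
  rw [Measure.map_addHaar_smul _ hr]
  exact Measure.smul_absolutelyContinuous

/-- A state whose momentum space wave function is a test function `g` is the inverse Fourier
transform of a Schwartz function supported in the rescaled support of `g`. -/
lemma exists_schwartz_of_momentumWaveFunction {Φ : StateSpace 2} {g : Space 2 → ℂ}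
    (hg : ContDiff ℝ (⊤ : ℕ∞) g) (hc : HasCompactSupport g)
    (h : momentumWaveFunction Φ =ᵐ[volume] g) :
    ∃ φ : 𝓢(Space 2, ℂ), (𝓕 Φ : StateSpace 2) =ᵐ[volume] (𝓕 φ : 𝓢(Space 2, ℂ)) ∧
      ∀ ξ ∈ tsupport (𝓕 φ : 𝓢(Space 2, ℂ)), (2 * Real.pi) • ξ ∈ tsupport g := by
  have hp : (2 * Real.pi) ≠ 0 := by positivity
  -- The factor `2π` undoes the unitary normalization `(2π)^{-ν/2}` at `ν = 2`.
  set f : Space 2 → ℂ := fun ξ => ((2 * Real.pi : ℝ) : ℂ) * g ((2 * Real.pi) • ξ) with hf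
  have hf1 : ContDiff ℝ (⊤ : ℕ∞) f :=
    contDiff_const.mul (hg.comp (contDiff_const_smul _))
  have hf2 : HasCompactSupport f :=
    (hc.comp_homeomorph (Homeomorph.smulOfNeZero (2 * Real.pi) hp)).mul_left
  refine ⟨𝓕⁻ (hf2.toSchwartzMap hf1), ?_, ?_⟩
  · rw [FourierTransform.fourier_fourierInv_eq]
    filter_upwards [ae_comp_smul hp h] with ξ hξ
    rw [momentumWaveFunction, smul_smul, inv_mul_cancel₀ hp, one_smul] at hξ
    change _ = ((2 * Real.pi : ℝ) : ℂ) * g ((2 * Real.pi) • ξ)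
    have h2 : 2 * Real.pi * (2 * Real.pi) ^ (-((2 : ℕ) : ℝ) / 2) = 1 := by
      rw [show -((2 : ℕ) : ℝ) / 2 = -1 by norm_num, Real.rpow_neg_one, mul_inv_cancel₀ hp]
    rw [← hξ, ← mul_assoc, ← Complex.ofReal_mul, h2, Complex.ofReal_one, one_mul]
  · rw [FourierTransform.fourier_fourierInv_eq]
    intro ξ hξ
    have h1 : tsupport f ⊆ (fun ξ : Space 2 => (2 * Real.pi) • ξ) ⁻¹' tsupport g := by
      refine closure_minimal (fun y hy => ?_)
        ((isClosed_tsupport g).preimage (continuous_const_smul _))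
      refine subset_tsupport g (fun h0 => hy ?_)
      simp [hf, h0]
    exact h1 hξ

lemma freePhase_eq_quadPhase {ν : ℕ} (m t : ℝ) (ξ : Space ν) :
    freePhase m t ((2 * Real.pi) • ξ) = quadPhase (-(2 * Real.pi ^ 2 * t / m)) ξ := by
  rw [freePhase, quadPhase, norm_smul, mul_pow, Real.norm_eq_abs, sq_abs, ← mul_neg,
    ← Complex.ofReal_neg, mul_comm]
  congr 3
  ring

lemma freeEvolution_ae_eq {m t : ℝ} {Φ : StateSpace 2} {φ : 𝓢(Space 2, ℂ)}
    (h : (𝓕 Φ : StateSpace 2) =ᵐ[volume] (𝓕 φ : 𝓢(Space 2, ℂ))) :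
    freeEvolution m t Φ =ᵐ[volume]
      (𝓕⁻ (smulLeftCLM ℂ (quadPhase (-(2 * Real.pi ^ 2 * t / m))) (𝓕 φ)) : 𝓢(Space 2, ℂ)) := by
  have h1 : (memLp_freePhase_mul m t (𝓕 Φ : StateSpace 2)).toLp _ =
      (smulLeftCLM ℂ (quadPhase (-(2 * Real.pi ^ 2 * t / m))) (𝓕 φ)).toLp 2 := by
    refine (MemLp.toLp_eq_toLp_iff _ _).2 ?_
    filter_upwards [h] with ξ hξ
    rw [hξ, freePhase_eq_quadPhase,
      smulLeftCLM_apply_apply (hasTemperateGrowth_quadPhase _), smul_eq_mul]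
  rw [freeEvolution, h1, SchwartzMap.toLp_fourierInv_eq]
  exact coeFn_toLp _ _ _

/-- Localized states decay like `1 / |t|` uniformly in space, and rapidly in `L²` off the ball of
radius `|t| ‖v‖ / 3` moving with the mean velocity `v`. -/
lemma exists_freeEvolution_bounds {m : ℝ} (hm : 0 < m) {Φ : StateSpace 2}
    (hΦ : Φ ∈ localizedStates 2 m) :
    ∃ v : Space 2, v ≠ 0 ∧ ∃ C : ℝ, 0 ≤ C ∧ ∀ t : ℝ, t ≠ 0 →
      (∀ᵐ x, ‖freeEvolution m t Φ x‖ ≤ C / |t|) ∧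
      eLpNorm ({x : Space 2 | |t| * ‖v‖ / 3 ≤ ‖x - t • v‖}.indicator (freeEvolution m t Φ)) 2 volume
        ≤ ENNReal.ofReal (C / |t| ^ 3) := by
  obtain ⟨-, g, hg, hc, hgΦ, v, hv, hsupp⟩ := hΦ
  obtain ⟨φ, hφ, hφs⟩ := exists_schwartz_of_momentumWaveFunction hg hc hgΦ
  obtain ⟨C, hC, hb⟩ := freeEvolution_schwartz_bounds φ
  set c : ℝ := 2 * Real.pi ^ 2 / m with hcdef
  have hc0 : 0 < c := by positivity
  refine ⟨v, hv, max (C / c) (C / c ^ 3), le_max_of_le_left (by positivity), fun t ht => ?_⟩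
  have ht' : 0 < |t| := abs_pos.2 ht
  have ha : 2 * Real.pi ^ 2 * t / m = c * t := by rw [hcdef]; ring
  have hae := freeEvolution_ae_eq (m := m) (t := t) hφ
  rw [ha] at hae
  obtain ⟨hb1, hb2⟩ := hb (c * t) (mul_ne_zero hc0.ne' ht)
  have habs : |c * t| = c * |t| := by rw [abs_mul, abs_of_pos hc0]
  constructor
  · filter_upwards [hae] with x hx
    rw [hx]
    refine (hb1 x).trans ?_
    rw [habs, ← div_div]
    gcongr
    exact le_max_left _ _
  · refine (eLpNorm_mono_ae (hae.mono fun x hx => ?_)).trans (hb2.trans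
      (ENNReal.ofReal_le_ofReal ?_))
    · by_cases hx1 : |t| * ‖v‖ / 3 ≤ ‖x - t • v‖
      · have hx2 : (Real.pi / (c * t)) • x ∉ tsupport (𝓕 φ : 𝓢(Space 2, ℂ)) := by
          intro hx2
          have h1 := hsupp (hφs _ hx2)
          rw [Metric.mem_ball, dist_eq_norm, smul_smul] at h1
          -- The frequency `πx/(ct)` is the momentum `mx/t`, so the momentum ball about `m • v`
          -- becomes the ball of radius `|t|‖v‖/3` about `t • v`.
          have h2 : (2 * Real.pi * (Real.pi / (c * t))) • x - m • v = (m / t) • (x - t • v) := by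
            rw [smul_sub, smul_smul, hcdef]
            congr 2 <;> field_simp
          rw [h2, norm_smul, norm_div, Real.norm_of_nonneg hm.le, Real.norm_eq_abs] at h1
          have h3 : m * ‖v‖ / 3 = m / |t| * (|t| * ‖v‖ / 3) := by field_simp
          rw [h3] at h1
          exact absurd (lt_of_mul_lt_mul_left h1 (by positivity)) (not_lt.2 hx1)
        rw [Set.indicator_of_mem (by simpa using hx1), Set.indicator_of_mem (by simpa using hx2),
          hx]
      · rw [Set.indicator_of_notMem (by simpa using hx1), norm_zero]
        exact norm_nonneg _
    · rw [habs, mul_pow, ← div_div]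
      gcongr
      exact le_max_right _ _

end

/-! ### Rotations and the area of a rotated rectangle. -/

lemma planeRotation_symm_apply_zero (θ : ℝ) (x : Space 2) :
    (planeRotation θ).symm x 0 = Real.cos θ * x 0 + Real.sin θ * x 1 := rfl

lemma planeRotation_symm_apply_one (θ : ℝ) (x : Space 2) :
    (planeRotation θ).symm x 1 = -Real.sin θ * x 0 + Real.cos θ * x 1 := rfl

lemma norm_planeRotation_symm (θ : ℝ) (x : Space 2) : ‖(planeRotation θ).symm x‖ = ‖x‖ := by
  rw [EuclideanSpace.norm_eq, EuclideanSpace.norm_eq]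
  congr 1
  simp only [Fin.sum_univ_two, Real.norm_eq_abs, sq_abs, planeRotation_symm_apply_zero,
    planeRotation_symm_apply_one]
  linear_combination (x 0 ^ 2 + x 1 ^ 2) * Real.sin_sq_add_cos_sq θ

/-- The inverse rotation as a linear isometry. -/
def planeRotationSymm (θ : ℝ) : Space 2 ≃ₗᵢ[ℝ] Space 2 where
  toFun := (planeRotation θ).symm
  invFun := planeRotation θ
  left_inv := (planeRotation θ).right_inv
  right_inv := (planeRotation θ).left_inv
  map_add' x y := by
    ext i
    fin_cases i <;> simp [planeRotation_symm_apply_zero, planeRotation_symm_apply_one] <;> ring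
  map_smul' c x := by
    ext i
    fin_cases i <;> simp [planeRotation_symm_apply_zero, planeRotation_symm_apply_one] <;> ring
  norm_map' x := norm_planeRotation_symm θ x

lemma volume_rotated_rectangle (θ : ℝ) {L d : ℝ} (hL : 0 ≤ L) :
    volume {x : Space 2 | |(planeRotation θ).symm x 0| ≤ L ∧ |(planeRotation θ).symm x 1| ≤ d} =
      ENNReal.ofReal (4 * L * d) := by
  have h1 := (planeRotationSymm θ).measurePreserving
  have h2 := EuclideanSpace.volume_preserving_symm_measurableEquiv_toLp (Fin 2)
  have h3 : {x : Space 2 | |(planeRotation θ).symm x 0| ≤ L ∧ |(planeRotation θ).symm x 1| ≤ d} =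
      planeRotationSymm θ ⁻¹' ((MeasurableEquiv.toLp 2 (Fin 2 → ℝ)).symm ⁻¹'
        Set.Icc ![-L, -d] ![L, d]) := by
    ext x
    simp only [Set.mem_preimage, Set.mem_Icc, Pi.le_def, Fin.forall_fin_two, Set.mem_ofPred_eq,
      abs_le]
    exact and_and_and_comm
  have hm : MeasurableSet (Set.Icc ![-L, -d] ![L, d]) := measurableSet_Icc
  rw [h3, h1.measure_preimage (h2.measurable hm).nullMeasurableSet,
    h2.measure_preimage hm.nullMeasurableSet, Real.volume_Icc_pi]
  simp only [Fin.prod_univ_two, Matrix.cons_val_zero, Matrix.cons_val_one]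
  rw [← ENNReal.ofReal_mul (by linarith)]
  congr 1
  ring

/-! ### Norm bounds for multiplication operators. -/

lemma norm_freeEvolution {ν : ℕ} (m t : ℝ) (Φ : StateSpace ν) : ‖freeEvolution m t Φ‖ = ‖Φ‖ := by
  have h1 : ‖freeEvolution m t Φ‖ =
      ‖(memLp_freePhase_mul m t (𝓕 Φ : StateSpace ν)).toLp _‖ :=
    (Lp.fourierTransformₗᵢ (Space ν) ℂ).symm.norm_map _
  rw [h1, ← Lp.norm_fourier_eq Φ, Lp.norm_toLp, Lp.norm_def]
  congr 1
  exact eLpNorm_congr_norm_ae (Filter.Eventually.of_forall fun ξ => by simp [norm_freePhase])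

lemma eLpNorm_ofReal_mul_le {ν : ℕ} {W : Space ν → ℝ} {K : ℝ} (hK : ∀ x, |W x| ≤ K)
    (f : Space ν → ℂ) :
    eLpNorm (fun x => (W x : ℂ) * f x) 2 volume ≤ ENNReal.ofReal K * eLpNorm f 2 volume := by
  refine eLpNorm_le_mul_eLpNorm_of_ae_le_mul (Filter.Eventually.of_forall fun x => ?_) 2
  rw [norm_mul, Complex.norm_real, Real.norm_eq_abs]
  exact mul_le_mul_of_nonneg_right (hK x) (norm_nonneg _)

lemma memLp_ofReal_mul {ν : ℕ} {W : Space ν → ℝ} (hW : Continuous W) {K : ℝ}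
    (hK : ∀ x, |W x| ≤ K) (Ψ : StateSpace ν) :
    MemLp (fun x => (W x : ℂ) * Ψ x) 2 volume :=
  ⟨(Complex.continuous_ofReal.comp hW).aestronglyMeasurable.mul (Lp.aestronglyMeasurable Ψ),
    (eLpNorm_ofReal_mul_le hK Ψ).trans_lt (ENNReal.mul_lt_top ENNReal.ofReal_lt_top
      (Lp.memLp Ψ).2)⟩

lemma MulNormLE.mono {ν : ℕ} {W : Space ν → ℝ} {Ψ : StateSpace ν} {c c' : ℝ}
    (h : MulNormLE W Ψ c) (hc : c ≤ c') : MulNormLE W Ψ c' :=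
  ⟨h.1, h.2.trans (ENNReal.ofReal_le_ofReal hc)⟩

lemma mulNormLE_of_bounded {ν : ℕ} {W : Space ν → ℝ} (hW : Continuous W) {K : ℝ}
    (hK : ∀ x, |W x| ≤ K) {Ψ : StateSpace ν} (hΨ : ‖Ψ‖ = 1) : MulNormLE W Ψ K := by
  refine ⟨memLp_ofReal_mul hW hK Ψ, (eLpNorm_ofReal_mul_le hK Ψ).trans (le_of_eq ?_)⟩
  have h1 : eLpNorm Ψ 2 volume = 1 := by
    rw [Lp.norm_def, ENNReal.toReal_eq_one_iff] at hΨ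
    exact hΨ
  rw [h1, mul_one]

/-- Bound for a multiplication operator on a state that is small in `L²` on a set `S` and uniformly
bounded elsewhere, when the support of the multiplier off `S` is contained in a set `B`. -/
lemma mulNormLE_of_split {ν : ℕ} {W : Space ν → ℝ} (hW : Continuous W) {Ψ : StateSpace ν}
    {S B : Set (Space ν)} (hS : MeasurableSet S) (hB : MeasurableSet B) {K A M ε b : ℝ}
    (hK : ∀ x, |W x| ≤ K) (hA : ∀ x ∉ S, |W x| ≤ A) (hA0 : 0 ≤ A) (hWB : ∀ x ∉ S, W x ≠ 0 → x ∈ B)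
    (hΨ : ∀ᵐ x, ‖Ψ x‖ ≤ M) (hM : 0 ≤ M) (hb : volume B ≤ ENNReal.ofReal b) (hb0 : 0 ≤ b)
    (hε : eLpNorm (S.indicator Ψ) 2 volume ≤ ENNReal.ofReal ε) (hε0 : 0 ≤ ε) :
    MulNormLE W Ψ (K * ε + A * M * √b) := by
  have hK0 : 0 ≤ K := (abs_nonneg _).trans (hK 0)
  have hmem := memLp_ofReal_mul hW hK Ψ
  refine ⟨hmem, ?_⟩
  set f : Space ν → ℂ := fun x => (W x : ℂ) * Ψ x with hf
  have h1 : eLpNorm (S.indicator f) 2 volume ≤ ENNReal.ofReal (K * ε) := by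
    have : S.indicator f = fun x => (W x : ℂ) * S.indicator Ψ x := by
      ext x
      by_cases hx : x ∈ S <;> simp [hx, hf]
    rw [this, ENNReal.ofReal_mul hK0]
    exact (eLpNorm_ofReal_mul_le hK _).trans (mul_le_mul_right hε _)
  have h2 : eLpNorm (Sᶜ.indicator f) 2 volume ≤ ENNReal.ofReal (A * M * √b) := by
    have h3 : ∀ᵐ x, ‖Sᶜ.indicator f x‖ ≤ ‖B.indicator (fun _ => A * M) x‖ := by
      filter_upwards [hΨ] with x hx
      by_cases hxS : x ∈ S
      · rw [Set.indicator_of_notMem (by simpa using hxS), norm_zero]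
        exact norm_nonneg _
      · rw [Set.indicator_of_mem (by simpa using hxS)]
        by_cases hW0 : W x = 0
        · simp [hf, hW0]
        · rw [Set.indicator_of_mem (hWB x hxS hW0), hf, norm_mul, Complex.norm_real,
            Real.norm_eq_abs, Real.norm_of_nonneg (by positivity)]
          exact mul_le_mul (hA x hxS) hx (norm_nonneg _) hA0
    refine (eLpNorm_mono_ae h3).trans ?_
    rw [eLpNorm_indicator_const hB (by norm_num) (by norm_num),
      Real.enorm_eq_ofReal (by positivity), ENNReal.ofReal_mul (by positivity : 0 ≤ A * M)]
    refine mul_le_mul_right ?_ _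
    refine (ENNReal.rpow_le_rpow hb (by norm_num)).trans (le_of_eq ?_)
    rw [ENNReal.ofReal_rpow_of_nonneg hb0 (by norm_num), Real.sqrt_eq_rpow]
    norm_num
  have h3 : f = S.indicator f + Sᶜ.indicator f := (Set.indicator_self_add_compl S f).symm
  rw [h3, ENNReal.ofReal_add (by positivity) (by positivity)]
  exact (eLpNorm_add_le (hmem.1.indicator hS) (hmem.1.indicator hS.compl) (by norm_num)).trans
    (add_le_add h1 h2)

lemma abs_apply_le_norm (y : Space 2) (i : Fin 2) : |y i| ≤ ‖y‖ := by
  simpa using PiLp.norm_apply_le y i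

lemma norm_le_abs_add_abs (y : Space 2) : ‖y‖ ≤ |y 0| + |y 1| := by
  rw [EuclideanSpace.norm_eq, Real.sqrt_le_left (by positivity)]
  simp only [Fin.sum_univ_two, Real.norm_eq_abs]
  nlinarith [abs_nonneg (y 0), abs_nonneg (y 1)]

/-- A bounded multiplier supported in a rotated strip, on a state localized near `t • v`. -/
lemma mulNormLE_of_strip {W : Space 2 → ℝ} (hW : Continuous W) {Ψ : StateSpace 2} {v : Space 2}
    {t θ d K A C : ℝ} (ht : t ≠ 0) (hC : 0 ≤ C) (hd : 0 ≤ d) (hdt : 6 * d ≤ |t| * ‖v‖)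
    (hK : ∀ x, |W x| ≤ K) (hstrip : ∀ x, W x ≠ 0 → |(planeRotation θ).symm x 1| ≤ d) (hA0 : 0 ≤ A)
    (hA : ∀ x, |t| * ‖v‖ / 2 ≤ |(planeRotation θ).symm x 0| →
      |(planeRotation θ).symm x 0| ≤ 2 * (|t| * ‖v‖) → |(planeRotation θ).symm x 1| ≤ d →
      |W x| ≤ A)
    (hΨ : ∀ᵐ x, ‖Ψ x‖ ≤ C / |t|)
    (hΨ2 : eLpNorm ({x : Space 2 | |t| * ‖v‖ / 3 ≤ ‖x - t • v‖}.indicator Ψ) 2 volume ≤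
      ENNReal.ofReal (C / |t| ^ 3)) :
    MulNormLE W Ψ (K * (C / |t| ^ 3) + A * (C / |t|) * √(4 * (2 * (|t| * ‖v‖)) * d)) := by
  have hr : ∀ i : Fin 2, Continuous fun x : Space 2 => (planeRotation θ).symm x i := fun i =>
    (EuclideanSpace.proj i : Space 2 →L[ℝ] ℝ).continuous.comp (planeRotationSymm θ).continuous
  -- In the ball, `‖x‖` lies between `2/3` and `4/3` of `|t|‖v‖`. The transverse coordinate takes at
  -- most `d ≤ |t|‖v‖/6`, which leaves at least `1/2` for the long one.
  have hgood : ∀ x, x ∉ {x : Space 2 | |t| * ‖v‖ / 3 ≤ ‖x - t • v‖} →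
      |(planeRotation θ).symm x 1| ≤ d → |t| * ‖v‖ / 2 ≤ |(planeRotation θ).symm x 0| ∧
        |(planeRotation θ).symm x 0| ≤ 2 * (|t| * ‖v‖) := by
    intro x hx hx1
    have hx : ‖x - t • v‖ < |t| * ‖v‖ / 3 := not_le.1 hx
    have hn : ‖t • v‖ = |t| * ‖v‖ := by rw [norm_smul, Real.norm_eq_abs]
    have h1 : ‖t • v‖ ≤ ‖x‖ + ‖x - t • v‖ := by
      have := norm_sub_le x (x - t • v)
      rwa [sub_sub_cancel] at this
    have h2 : ‖x‖ ≤ ‖t • v‖ + ‖x - t • v‖ := norm_le_norm_add_norm_sub' x (t • v)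
    have h3 := norm_le_abs_add_abs ((planeRotation θ).symm x)
    have h4 := abs_apply_le_norm ((planeRotation θ).symm x) 0
    rw [norm_planeRotation_symm] at h3 h4
    constructor <;> linarith
  refine mulNormLE_of_split hW (S := {x : Space 2 | |t| * ‖v‖ / 3 ≤ ‖x - t • v‖})
    (B := {x : Space 2 | |(planeRotation θ).symm x 0| ≤ 2 * (|t| * ‖v‖) ∧
      |(planeRotation θ).symm x 1| ≤ d}) ?_ ?_ hK ?_ hA0 ?_ hΨ (by positivity)
      (volume_rotated_rectangle θ (by positivity)).le (by positivity) hΨ2 (by positivity)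
  · exact (isClosed_le continuous_const (by fun_prop)).measurableSet
  · exact ((isClosed_le (hr 0).abs continuous_const).inter
      (isClosed_le (hr 1).abs continuous_const)).measurableSet
  · intro x hx
    by_cases h1 : |(planeRotation θ).symm x 1| ≤ d
    · exact hA x (hgood x hx h1).1 (hgood x hx h1).2 h1
    · rw [not_imp_comm.1 (hstrip x) h1, abs_zero]
      exact hA0
  · intro x hx hx0
    exact ⟨(hgood x hx (hstrip x hx0)).2, hstrip x hx0⟩

/-! ### Pointwise consequences of the decay hypothesis, and the time derivative. -/

lemma sqrt_mul_abs_le_and_abs_deriv_le_of_tailSup {f : ℝ → ℝ} {h : ℝ → ℝ}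
    (hbound : ∀ ρ : ℝ, 0 ≤ ρ →
      ENNReal.ofReal (ρ ^ (1 / 2 : ℝ)) * tailSup f ρ
        + ENNReal.ofReal ((1 / (1 + ρ)) ^ (1 / 2 : ℝ)) * tailSup (deriv f) ρ
        ≤ ENNReal.ofReal (h ρ)) {ρ y : ℝ} (hρ : 0 ≤ ρ) (hy : ρ ≤ |y|) :
    √ρ * |f y| ≤ |h ρ| ∧ |deriv f y| ≤ √(1 + ρ) * |h ρ| := by
  have hle : ∀ g : ℝ → ℝ, ENNReal.ofReal |g y| ≤ tailSup g ρ := fun g => by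
    rw [← Real.enorm_eq_ofReal_abs]
    exact le_iSup₂ (f := fun (z : ℝ) (_ : z ∈ {z : ℝ | ρ ≤ |z|}) => ‖g z‖ₑ) y hy
  have hh : ENNReal.ofReal (h ρ) ≤ ENNReal.ofReal |h ρ| :=
    ENNReal.ofReal_le_ofReal (le_abs_self _)
  have key : ∀ (c : ℝ) (g : ℝ → ℝ), 0 ≤ c → ENNReal.ofReal c * tailSup g ρ ≤
      ENNReal.ofReal (h ρ) → c * |g y| ≤ |h ρ| := fun c g hc hg => by
    rw [← ENNReal.ofReal_le_ofReal_iff (abs_nonneg _), ENNReal.ofReal_mul hc]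
    exact (mul_le_mul_right (hle g) _).trans (hg.trans hh)
  have hb := hbound ρ hρ
  rw [← Real.sqrt_eq_rpow, ← Real.sqrt_eq_rpow] at hb
  refine ⟨key _ _ (Real.sqrt_nonneg _) (le_self_add.trans hb), ?_⟩
  have h2 := key _ (deriv f) (Real.sqrt_nonneg _) (le_add_self.trans hb)
  rw [Real.sqrt_div zero_le_one, Real.sqrt_one, one_div, inv_mul_le_iff₀ (by positivity)] at h2
  exact h2

/-- If `√ρ · sup_{|y| ≥ ρ} |f y|` is integrable, then `y f(y)` is bounded away from the origin. -/
lemma abs_mul_abs_le_of_sqrt_mul_le {f h : ℝ → ℝ} (hint : IntegrableOn h (Set.Ici 0) volume)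
    (hf : ∀ ρ y : ℝ, 0 ≤ ρ → ρ ≤ |y| → √ρ * |f y| ≤ |h ρ|) {y : ℝ} (hy : 1 ≤ |y|) :
    |y| * |f y| ≤ 4 * ∫ ρ in Set.Ici 0, |h ρ| := by
  have hsub : Set.Icc (|y| / 2) |y| ⊆ Set.Ici 0 := fun ρ hρ =>
    le_trans (by positivity) hρ.1
  have hint2 : IntegrableOn (fun ρ => |h ρ|) (Set.Ici 0) volume := hint.abs
  -- On this interval of length `|y|/2`, `ρ ≥ 1/2` and hence `√ρ ≥ 1/2`; this is the origin of the
  -- constant `4`.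
  have h1 : ∫ ρ in Set.Icc (|y| / 2) |y|, (1 / 2 * |f y|) ≤
      ∫ ρ in Set.Icc (|y| / 2) |y|, |h ρ| := by
    refine setIntegral_mono_on continuous_const.integrableOn_Icc (hint2.mono_set hsub) measurableSet_Icc fun ρ hρ => ?_
    refine le_trans (mul_le_mul_of_nonneg_right ?_ (abs_nonneg _)) (hf ρ y (hsub hρ) hρ.2)
    refine Real.le_sqrt_of_sq_le ?_
    have := hρ.1
    norm_num
    linarith
  have h2 : ∫ ρ in Set.Icc (|y| / 2) |y|, |h ρ| ≤ ∫ ρ in Set.Ici 0, |h ρ| :=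
    setIntegral_mono_set hint2 (Filter.Eventually.of_forall fun _ => abs_nonneg _)
      (Filter.Eventually.of_forall hsub)
  rw [setIntegral_const, Real.volume_real_Icc_of_le (by linarith), smul_eq_mul] at h1
  nlinarith

lemma integrable_abs_comp_mul_abs {h : ℝ → ℝ} (hint : IntegrableOn h (Set.Ici 0) volume) {c : ℝ}
    (hc : 0 < c) : Integrable (fun t : ℝ => |h (c * |t|)|) volume := by
  have h1 : Integrable ((Set.Ici 0).indicator h) volume :=
    hint.integrable_indicator measurableSet_Ici
  have h2 := (h1.comp_mul_left' hc.ne').add (h1.comp_mul_left' (neg_ne_zero.2 hc.ne'))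
  refine (h2.congr ?_).abs
  -- Both reflected copies of `h` contribute at `t = 0`, so that point is discarded.
  filter_upwards [Measure.ae_ne volume (0 : ℝ)] with t ht
  rcases lt_or_gt_of_ne ht with h0 | h0
  · have e1 : c * t < 0 := mul_neg_of_pos_of_neg hc h0
    simp [Set.indicator, e1, e1.le, abs_of_neg h0]
  · have e1 : 0 < c * t := mul_pos hc h0
    simp [Set.indicator, e1, e1.le, abs_of_pos h0]

lemma exists_abs_le_of_continuous_of_tail {f : ℝ → ℝ} (hf : Continuous f) {M : ℝ}
    (hM : ∀ y, 1 ≤ |y| → |f y| ≤ M) : ∃ B : ℝ, ∀ y, |f y| ≤ B := by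
  obtain ⟨B, hB⟩ := (isCompact_Icc (a := (-1 : ℝ)) (b := 1)).exists_bound_of_continuousOn
    hf.continuousOn
  refine ⟨max B M, fun y => ?_⟩
  rcases le_total |y| 1 with h | h
  · exact (hB y (abs_le.1 h)).trans (le_max_left _ _)
  · exact (hM y h).trans (le_max_right _ _)

/-- Chain rule in rotating coordinates. The grouping keeps each coordinate next to the factor that
tames it: compact support for `V₂`, decay at infinity for `V₁`. -/
lemma rotatingPotentialDeriv_eq (ω : ℝ) {V : Space 2 → ℝ} {V₁ V₂ : ℝ → ℝ}
    (hprod : ∀ x : Space 2, V x = V₁ (x 0) * V₂ (x 1)) (h₁ : Differentiable ℝ V₁)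
    (h₂ : Differentiable ℝ V₂) (t : ℝ) (x : Space 2) :
    rotatingPotentialDeriv ω V t x =
      ω * (deriv V₁ ((planeRotation (ω * t)).symm x 0) *
          ((planeRotation (ω * t)).symm x 1 * V₂ ((planeRotation (ω * t)).symm x 1)) -
        (planeRotation (ω * t)).symm x 0 * V₁ ((planeRotation (ω * t)).symm x 0) *
          deriv V₂ ((planeRotation (ω * t)).symm x 1)) := by
  have hω : HasDerivAt (fun s => ω * s) (ω * 1) t := (hasDerivAt_id t).const_mul ω
  have h0 : HasDerivAt (fun s => (planeRotation (ω * s)).symm x 0)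
      (ω * (planeRotation (ω * t)).symm x 1) t := by
    simp only [planeRotation_symm_apply_zero, planeRotation_symm_apply_one]
    exact ((hω.cos.mul_const (x 0)).add (hω.sin.mul_const (x 1))).congr_deriv (by ring)
  have h1 : HasDerivAt (fun s => (planeRotation (ω * s)).symm x 1)
      (-(ω * (planeRotation (ω * t)).symm x 0)) t := by
    simp only [planeRotation_symm_apply_zero, planeRotation_symm_apply_one]
    exact ((hω.sin.neg.mul_const (x 0)).add (hω.cos.mul_const (x 1))).congr_deriv (by ring)
  have h3 := ((h₁ _).hasDerivAt.comp t h0).mul ((h₂ _).hasDerivAt.comp t h1)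
  have h4 : (fun s => rotatingPotential ω V s x) =
      (V₁ ∘ fun s => (planeRotation (ω * s)).symm x 0) *
        (V₂ ∘ fun s => (planeRotation (ω * s)).symm x 1) := by
    ext s
    exact hprod _
  rw [rotatingPotentialDeriv, h4, h3.deriv]
  simp only [Function.comp]
  ring

/-! ### Elementary inequalities for large and small times. -/

lemma add_div_le_div_one_add {D a b H s : ℝ} (hs : 1 ≤ s) (ha : 0 ≤ a) (hb : 0 ≤ b) (hH : 0 ≤ H)
    (haD : 4 * a ≤ D) (hbD : 2 * b ≤ D) :
    a / s ^ 3 + b * H / s ≤ D * ((1 + s ^ 2)⁻¹ + H) / (1 + s) := by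
  have hs0 : 0 < s := by linarith
  have h1 : a / s ^ 3 ≤ D * (1 + s ^ 2)⁻¹ / (1 + s) := by
    rw [← div_eq_mul_inv, div_div, div_le_div_iff₀ (by positivity) (by positivity)]
    have : (1 + s ^ 2) * (1 + s) ≤ 4 * s ^ 3 := by nlinarith [mul_nonneg hs0.le (sub_nonneg.2 hs)]
    calc a * ((1 + s ^ 2) * (1 + s)) ≤ a * (4 * s ^ 3) := by gcongr
      _ = 4 * a * s ^ 3 := by ring
      _ ≤ D * s ^ 3 := by gcongr
  have h2 : b * H / s ≤ D * H / (1 + s) := by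
    rw [div_le_div_iff₀ hs0 (by positivity)]
    calc b * H * (1 + s) ≤ b * H * (2 * s) := by gcongr; linarith
      _ = 2 * b * (H * s) := by ring
      _ ≤ D * (H * s) := by gcongr
      _ = D * H * s := by ring
  rw [mul_add, add_div]
  exact add_le_add h1 h2

lemma add_div_le_mul {D a b H s : ℝ} (hs : 1 ≤ s) (ha : 0 ≤ a) (hH : 0 ≤ H)
    (haD : 4 * a ≤ D) (hbD : b ≤ D) :
    a / s ^ 3 + b * H ≤ D * ((1 + s ^ 2)⁻¹ + H) := by
  have h1 : a / s ^ 3 ≤ D * (1 + s ^ 2)⁻¹ := by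
    rw [← div_eq_mul_inv, div_le_div_iff₀ (by positivity) (by positivity)]
    have : 1 + s ^ 2 ≤ 4 * s ^ 3 := by nlinarith [mul_nonneg (sq_nonneg s) (sub_nonneg.2 hs)]
    calc a * (1 + s ^ 2) ≤ a * (4 * s ^ 3) := by gcongr
      _ = 4 * a * s ^ 3 := by ring
      _ ≤ D * s ^ 3 := by gcongr
  rw [mul_add]
  exact add_le_add h1 (mul_le_mul_of_nonneg_right hbD hH)

lemma le_div_one_add_of_le {D K T H s : ℝ} (hs : 0 ≤ s) (hsT : s ≤ T) (hK : 0 ≤ K) (hH : 0 ≤ H)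
    (hD : K * ((1 + T ^ 2) * (1 + T)) ≤ D) :
    K ≤ D * ((1 + s ^ 2)⁻¹ + H) / (1 + s) := by
  have hT : 0 ≤ T := hs.trans hsT
  have hD0 : 0 ≤ D := le_trans (by positivity) hD
  calc K ≤ D * (1 + s ^ 2)⁻¹ / (1 + s) := by
        rw [← div_eq_mul_inv, div_div, le_div_iff₀ (by positivity)]
        refine le_trans ?_ hD
        gcongr
    _ ≤ _ := by gcongr; linarith

/-! ### Regularity of the factors and the main estimate. -/

/-- Freezing one coordinate where its factor is nonzero recovers the other factor from `V`. -/
lemma contDiff_factors {V : Space 2 → ℝ} {V₁ V₂ : ℝ → ℝ}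
    (hprod : ∀ x : Space 2, V x = V₁ (x 0) * V₂ (x 1)) (hV : ContDiff ℝ 1 V) {a b : ℝ}
    (ha : V₁ a ≠ 0) (hb : V₂ b ≠ 0) : ContDiff ℝ 1 V₁ ∧ ContDiff ℝ 1 V₂ := by
  have h1 : V₁ = fun y => V (WithLp.toLp 2 ![y, b]) / V₂ b := by
    ext y
    rw [hprod, eq_div_iff hb]
    rfl
  have h2 : V₂ = fun y => V (WithLp.toLp 2 ![a, y]) / V₁ a := by
    ext y
    rw [hprod, eq_div_iff ha, mul_comm]
    rfl
  have hc : ∀ f : ℝ → Fin 2 → ℝ, (∀ i, ContDiff ℝ 1 fun y => f y i) →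
      ContDiff ℝ 1 fun y => V (WithLp.toLp 2 (f y)) := fun f hf =>
    hV.comp ((PiLp.contDiff_toLp (p := 2)).comp (contDiff_pi.2 hf))
  constructor
  · rw [h1]
    refine (hc (fun y => ![y, b]) fun i => ?_).div_const _
    fin_cases i
    · exact contDiff_id
    · exact contDiff_const
  · rw [h2]
    refine (hc (fun y => ![a, y]) fun i => ?_).div_const _
    fin_cases i
    · exact contDiff_const
    · exact contDiff_id

theorem lemma2p3 (m ω d : ℝ) (hm : 0 < m)
    (V : Space 2 → ℝ) (V₁ V₂ : ℝ → ℝ)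
    (hprod : ∀ x : Space 2, V x = V₁ (x 0) * V₂ (x 1))
    (hV : ContDiff ℝ 1 V)
    (hsupp : tsupport V₂ ⊆ Set.Icc (-d) d)
    (h : ℝ → ℝ) (hint : IntegrableOn h (Set.Ici 0) volume)
    (hbound : ∀ ρ : ℝ, 0 ≤ ρ →
      ENNReal.ofReal (ρ ^ (1 / 2 : ℝ)) * tailSup V₁ ρ
        + ENNReal.ofReal ((1 / (1 + ρ)) ^ (1 / 2 : ℝ)) * tailSup (deriv V₁) ρ
        ≤ ENNReal.ofReal (h ρ)) :
    ∀ Φ ∈ localizedStates 2 m,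
      ∃ k : ℝ → ℝ, Integrable k volume ∧ (∀ t, 0 < k t) ∧
        (∀ t, MulNormLE (rotatingPotential ω V t) (freeEvolution m t Φ) (k t / (1 + |t|))) ∧
        (∀ t, MulNormLE (rotatingPotentialDeriv ω V t) (freeEvolution m t Φ) (k t)) := by
  intro Φ hΦ
  have hnorm : ∀ t, ‖freeEvolution m t Φ‖ = 1 := fun t => by rw [norm_freeEvolution, hΦ.1]
  -- If one factor vanishes identically, the other may be irregular, but then `V = 0`.
  by_cases h0 : (∀ y, V₁ y = 0) ∨ (∀ y, V₂ y = 0)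
  · have hV0 : ∀ x, V x = 0 := fun x => by rcases h0 with h0 | h0 <;> simp [hprod, h0]
    have hW : ∀ t, rotatingPotential ω V t = 0 := fun t => funext fun x => hV0 _
    have hW' : ∀ t, rotatingPotentialDeriv ω V t = 0 := fun t => funext fun x => by
      simp [rotatingPotentialDeriv, hW]
    have hz : ∀ t, MulNormLE 0 (freeEvolution m t Φ) 0 := fun t =>
      mulNormLE_of_bounded continuous_zero (by simp) (hnorm t)
    refine ⟨fun t => (1 + t ^ 2)⁻¹, integrable_inv_one_add_sq, fun t => by positivity,
      fun t => ?_, fun t => ?_⟩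
    · rw [hW]
      exact (hz t).mono (by positivity)
    · rw [hW']
      exact (hz t).mono (by positivity)
  push Not at h0
  obtain ⟨⟨a, ha⟩, b, hb⟩ := h0
  obtain ⟨hV₁, hV₂⟩ := contDiff_factors hprod hV ha hb
  have hd : 0 ≤ d := by
    have := hsupp (subset_tsupport _ hb)
    linarith [this.1, this.2]
  have hV₂0 : ∀ y, d < |y| → V₂ y = 0 ∧ deriv V₂ y = 0 := by
    intro y hy
    have hy' : y ∉ tsupport V₂ := fun h' => not_le.2 hy (abs_le.2 (hsupp h'))
    exact ⟨image_eq_zero_of_notMem_tsupport hy',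
      image_eq_zero_of_notMem_tsupport fun h' => hy' (closure_minimal
        (support_deriv_subset (f := V₂)) (isClosed_tsupport V₂) h')⟩
  have hcomp : HasCompactSupport V₂ := isCompact_Icc.of_isClosed_subset (isClosed_tsupport _) hsupp
  obtain ⟨B₂, hB₂⟩ := hcomp.exists_bound_of_continuous hV₂.continuous
  obtain ⟨B₂', hB₂'⟩ := hcomp.deriv.exists_bound_of_continuous (hV₂.continuous_deriv le_rfl)
  simp only [Real.norm_eq_abs] at hB₂ hB₂'
  have hB₂0 : 0 ≤ B₂ := (abs_nonneg _).trans (hB₂ 0)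
  have hB₂'0 : 0 ≤ B₂' := (abs_nonneg _).trans (hB₂' 0)
  have htail : ∀ ρ y : ℝ, 0 ≤ ρ → ρ ≤ |y| →
      √ρ * |V₁ y| ≤ |h ρ| ∧ |deriv V₁ y| ≤ √(1 + ρ) * |h ρ| := fun ρ y hρ hy =>
    sqrt_mul_abs_le_and_abs_deriv_le_of_tailSup hbound hρ hy
  have hyV : ∀ y, 1 ≤ |y| → |y| * |V₁ y| ≤ 4 * ∫ ρ in Set.Ici 0, |h ρ| := fun y hy =>
    abs_mul_abs_le_of_sqrt_mul_le hint (fun ρ y hρ hy => (htail ρ y hρ hy).1) hy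
  obtain ⟨B₁, hB₁⟩ := exists_abs_le_of_continuous_of_tail hV₁.continuous fun y hy =>
    (le_mul_of_one_le_left (abs_nonneg _) hy).trans (hyV y hy)
  obtain ⟨E₁, hE₁⟩ := exists_abs_le_of_continuous_of_tail (f := fun y => y * V₁ y)
    (continuous_id.mul hV₁.continuous) fun y hy => by rw [abs_mul]; exact hyV y hy
  have hB₁' : ∀ y, |deriv V₁ y| ≤ |h 0| := fun y => by
    simpa using (htail 0 y le_rfl (abs_nonneg y)).2
  have hB₁0 : 0 ≤ B₁ := (abs_nonneg _).trans (hB₁ 0)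
  have hE₁0 : 0 ≤ E₁ := (abs_nonneg _).trans (hE₁ 0)
  have hyV₂ : ∀ y, |y * V₂ y| ≤ d * B₂ := by
    intro y
    rcases le_or_gt |y| d with hy | hy
    · rw [abs_mul]
      exact mul_le_mul hy (hB₂ y) (abs_nonneg _) hd
    · rw [(hV₂0 y hy).1, mul_zero, abs_zero]
      positivity
  have hWeq : ∀ t x, rotatingPotential ω V t x = V₁ ((planeRotation (ω * t)).symm x 0) *
      V₂ ((planeRotation (ω * t)).symm x 1) := fun t x => hprod _
  have hW'eq := rotatingPotentialDeriv_eq ω hprod (hV₁.differentiable one_ne_zero)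
    (hV₂.differentiable one_ne_zero)
  have hr : ∀ t (i : Fin 2), Continuous fun x : Space 2 => (planeRotation (ω * t)).symm x i :=
    fun t i => (EuclideanSpace.proj i : Space 2 →L[ℝ] ℝ).continuous.comp
      (planeRotationSymm (ω * t)).continuous
  have hWc : ∀ t, Continuous (rotatingPotential ω V t) := fun t => by
    simp only [funext (hWeq t)]
    exact (hV₁.continuous.comp (hr t 0)).mul (hV₂.continuous.comp (hr t 1))
  have hW'c : ∀ t, Continuous (rotatingPotentialDeriv ω V t) := fun t => by
    simp only [funext (hW'eq t)]
    exact continuous_const.mul ((((hV₁.continuous_deriv le_rfl).comp (hr t 0)).mul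
      ((hr t 1).mul (hV₂.continuous.comp (hr t 1)))).sub
      (((hr t 0).mul (hV₁.continuous.comp (hr t 0))).mul
        ((hV₂.continuous_deriv le_rfl).comp (hr t 1))))
  have hprodle : ∀ y z A A' : ℝ, |deriv V₁ y| ≤ A → |y * V₁ y| ≤ A' → 0 ≤ A → 0 ≤ A' →
      |ω * (deriv V₁ y * (z * V₂ z) - y * V₁ y * deriv V₂ z)| ≤
        |ω| * (A * (d * B₂) + A' * B₂') := by
    intro y z A A' h1 h2 hA hA'
    rw [abs_mul]
    refine mul_le_mul_of_nonneg_left ((abs_sub _ _).trans ?_) (abs_nonneg _)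
    rw [abs_mul (deriv V₁ y), abs_mul (y * V₁ y)]
    exact add_le_add (mul_le_mul h1 (hyV₂ z) (abs_nonneg _) hA)
      (mul_le_mul h2 (hB₂' z) (abs_nonneg _) hA')
  obtain ⟨K, hK0, hK⟩ : ∃ K, 0 ≤ K ∧ ∀ t x, |rotatingPotential ω V t x| ≤ K :=
    ⟨B₁ * B₂, by positivity, fun t x => by
      rw [hWeq, abs_mul]
      exact mul_le_mul (hB₁ _) (hB₂ _) (abs_nonneg _) hB₁0⟩
  obtain ⟨K', hK'0, hK'⟩ : ∃ K, 0 ≤ K ∧ ∀ t x, |rotatingPotentialDeriv ω V t x| ≤ K :=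
    ⟨|ω| * (|h 0| * (d * B₂) + E₁ * B₂'), by positivity, fun t x => by
      rw [hW'eq]
      exact hprodle _ _ _ _ (hB₁' _) (hE₁ _) (abs_nonneg _) hE₁0⟩
  obtain ⟨v, hv, C, hC, hΨ⟩ := exists_freeEvolution_bounds hm hΦ
  have hv0 : 0 < ‖v‖ := norm_pos_iff.2 hv
  set c := ‖v‖ / 2 with hc
  have hc0 : 0 < c := by positivity
  -- Beyond `T` all of `|t| ≥ 1`, `c|t| ≥ 1` and `6d ≤ |t|‖v‖` hold.
  set T := 1 + (2 + 6 * d) / ‖v‖ with hT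
  set G := |ω| * (2 * d * B₂ + 4 * B₂') with hG
  have hG0 : 0 ≤ G := by positivity
  set D := 1 + K * ((1 + T ^ 2) * (1 + T)) + K' * ((1 + T ^ 2) * (1 + T)) + 4 * (K * C) +
    4 * (K' * C) + 2 * (4 * B₂ * C * √d) + G * 2 * ‖v‖ * √d * C with hD
  have hT0 : 0 ≤ T := by positivity
  have n1 : 0 ≤ K * ((1 + T ^ 2) * (1 + T)) := by positivity
  have n2 : 0 ≤ K' * ((1 + T ^ 2) * (1 + T)) := by positivity
  have n3 : 0 ≤ K * C := by positivity
  have n4 : 0 ≤ K' * C := by positivity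
  have n5 : 0 ≤ 4 * B₂ * C * √d := by positivity
  have n6 : 0 ≤ G * 2 * ‖v‖ * √d * C := by positivity
  have hD0 : 0 < D := by linarith
  have hlarge : ∀ t, T ≤ |t| → 1 ≤ |t| ∧ 1 ≤ c * |t| ∧ 6 * d ≤ |t| * ‖v‖ := by
    intro t ht
    have h1 : 0 ≤ (2 + 6 * d) / ‖v‖ := by positivity
    have h2 : (2 + 6 * d) / ‖v‖ ≤ |t| := by linarith
    rw [div_le_iff₀ hv0] at h2
    refine ⟨by linarith, ?_, by linarith⟩
    rw [hc]
    nlinarith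
  have hvol : ∀ t, √(4 * (2 * (|t| * ‖v‖)) * d) = 4 * √(c * |t|) * √d := by
    intro t
    rw [show 4 * (2 * (|t| * ‖v‖)) * d = 4 ^ 2 * (c * |t|) * d by rw [hc]; ring,
      Real.sqrt_mul (by positivity), Real.sqrt_mul (by positivity),
      Real.sqrt_sq (by norm_num)]
  -- The first summand absorbs bounded times and the `|t|⁻³` remainder and makes the function
  -- positive; the second carries the tail of the potential.
  refine ⟨fun t => D * ((1 + |t| ^ 2)⁻¹ + |h (c * |t|)|), ?_, fun t => by positivity,
    fun t => ?_, fun t => ?_⟩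
  · simp only [sq_abs]
    exact (integrable_inv_one_add_sq.add (integrable_abs_comp_mul_abs hint hc0)).const_mul D
  · rcases le_total |t| T with ht | ht
    · refine (mulNormLE_of_bounded (hWc t) (hK t) (hnorm t)).mono ?_
      exact le_div_one_add_of_le (abs_nonneg _) ht hK0 (abs_nonneg _) (by linarith)
    · obtain ⟨ht1, hρ, h6d⟩ := hlarge t ht
      have htpos : 0 < |t| := by linarith
      have ht0 : t ≠ 0 := abs_pos.1 htpos
      have hρ0 : 0 < √(c * |t|) := Real.sqrt_pos.2 (by linarith)
      refine (mulNormLE_of_strip (θ := ω * t) (d := d) (A := |h (c * |t|)| / √(c * |t|) * B₂)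
        (hWc t) ht0 hC hd h6d (hK t) (fun x hx => ?_) (by positivity) (fun x hx1 _ _ => ?_)
        (hΨ t ht0).1 (hΨ t ht0).2).mono ?_
      · by_contra hx'
        exact hx (by rw [hWeq, (hV₂0 _ (not_le.1 hx')).1, mul_zero])
      · rw [hWeq, abs_mul]
        have := (htail (c * |t|) ((planeRotation (ω * t)).symm x 0) (by positivity)
          (by rw [hc]; linarith)).1
        rw [mul_comm] at this
        exact mul_le_mul ((le_div_iff₀ hρ0).2 this) (hB₂ _) (abs_nonneg _) (by positivity)
      · refine le_trans (le_of_eq ?_) (add_div_le_div_one_add (a := K * C)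
          (b := 4 * B₂ * C * √d) ht1 n3 n5 (abs_nonneg _) (by linarith) (by linarith))
        rw [hvol]
        field_simp
  · rcases le_total |t| T with ht | ht
    · refine (mulNormLE_of_bounded (hW'c t) (hK' t) (hnorm t)).mono ?_
      refine (le_div_one_add_of_le (D := D) (abs_nonneg t) ht hK'0 (abs_nonneg (h (c * |t|)))
        (by linarith)).trans ?_
      exact div_le_self (by positivity) (by linarith [abs_nonneg t])
    · obtain ⟨ht1, hρ, h6d⟩ := hlarge t ht
      have htpos : 0 < |t| := by linarith
      have ht0 : t ≠ 0 := abs_pos.1 htpos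
      have hρ0 : 0 < √(c * |t|) := Real.sqrt_pos.2 (by linarith)
      have hsq : √(c * |t|) * √(c * |t|) = c * |t| := Real.mul_self_sqrt (by positivity)
      refine (mulNormLE_of_strip (θ := ω * t) (d := d) (A := G * √(c * |t|) * |h (c * |t|)|)
        (hW'c t) ht0 hC hd h6d (hK' t) (fun x hx => ?_) (by positivity) (fun x hx1 hx2 _ => ?_)
        (hΨ t ht0).1 (hΨ t ht0).2).mono ?_
      · by_contra hx'
        refine hx ?_
        rw [hW'eq, (hV₂0 _ (not_le.1 hx')).1, (hV₂0 _ (not_le.1 hx')).2]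
        ring
      · rw [hW'eq]
        obtain ⟨h1, h2⟩ := htail (c * |t|) ((planeRotation (ω * t)).symm x 0) (by positivity)
          (by rw [hc]; linarith)
        -- Here `c|t| ≥ 1` is used; with `|y₀| ≤ 2|t|‖v‖ = 4c|t|` in the next bound it yields the
        -- constants `2` and `4` in `G`.
        have h3 : √(1 + c * |t|) ≤ 2 * √(c * |t|) := by
          rw [Real.sqrt_le_left (by positivity), mul_pow, Real.sq_sqrt (by positivity)]
          linarith
        have h4 : |(planeRotation (ω * t)).symm x 0 * V₁ ((planeRotation (ω * t)).symm x 0)| ≤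
            4 * (√(c * |t|) * |h (c * |t|)|) := by
          rw [abs_mul]
          calc _ ≤ 2 * (|t| * ‖v‖) * |V₁ ((planeRotation (ω * t)).symm x 0)| := by gcongr
            _ = 4 * (√(c * |t|) * √(c * |t|)) * |V₁ ((planeRotation (ω * t)).symm x 0)| := by
              rw [hsq, hc]; ring
            _ = 4 * (√(c * |t|) * (√(c * |t|) * |V₁ ((planeRotation (ω * t)).symm x 0)|)) := by
              ring
            _ ≤ _ := by gcongr
        refine (hprodle _ _ _ _ (h2.trans (mul_le_mul_of_nonneg_right h3 (abs_nonneg _))) h4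
          (by positivity) (by positivity)).trans (le_of_eq ?_)
        rw [hG]
        ring
      · refine le_trans (le_of_eq ?_) (add_div_le_mul (a := K' * C)
          (b := G * 2 * ‖v‖ * √d * C) ht1 n4 (abs_nonneg _) (by linarith) (by linarith))
        rw [hvol]
        rw [show G * √(c * |t|) * |h (c * |t|)| * (C / |t|) * (4 * √(c * |t|) * √d) =
          G * |h (c * |t|)| * (C / |t|) * 4 * √d * (√(c * |t|) * √(c * |t|)) by ring, hsq]
        generalize |h (c * |t|)| = H
        rw [hc]
        field_simp
        ring

end
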